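/- Let $Y_1,Y_2,\dots$ be i.i.d. random elements of a measurable space, with the same law as $Y$, and let $\psi(y;a)$, $a\in\mathbb{R}$, be a real score function, measurable in $y$ for every $a$. Let $a_0^\ast$ be the unique solution of $\Psi(a)=\mathbb{E}[\psi(Y;a)]=0$, and suppose that, for some $r>0$, almost surely $a\mapsto\psi(Y;a)$ is differentiable on $(a_0^\ast-r,a_0^\ast+r)$. Write $\Psi_n(a)=n^{-1}\sum_{i=1}^n\psi(Y_i;a)$ and $\Psi_n'(a)=n^{-1}\sum_{i=1}^n\partial_a\psi(Y_i;a)$. Assume: (A1) $\partial_a\psi(Y;a_0^\ast)$ is integrable and $A:=\mathbb{E}[\partial_a\psi(Y;a_0^\ast)]\neq0$; (A2) for every $\epsilon>0$ there is $\delta>0$ such that $\mathbb{P}\bigl(\sup_{|u-a_0^\ast|\le\delta}|\Psi_n'(u)-\Psi_n'(a_0^\ast)|>\epsilon\bigr)\to0$ as $n\to\infty$; (A3) $\mathbb{E}[\psi(Y;a_0^\ast)^2]<\infty$. (For events that are not known to be measurable, "probability tending to $0$" means that the outer probability tends to $0$, and "probability tending to $1$" means that the outer probability of the complement tends to $0$.)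 Then: (i) for every sufficiently small $\delta>0$, with probability tending to $1$ the equation $\Psi_n(a)=0$ has exactly one root in $[a_0^\ast-\delta,a_0^\ast+\delta]$; (ii) there are random variables $a_n^\ast$ such that $\Psi_n(a_n^\ast)=0$ with probability tending to $1$ and $a_n^\ast\to a_0^\ast$ in probability; (iii) for every sequence of random variables $a_n^\ast$ as in (ii), $$\sqrt{n}\,(a_n^\ast-a_0^\ast)\xrightarrow{d}N\!\left(0,\frac{B}{A^2}\right),\qquad B=\operatorname{Var}\bigl(\psi(Y;a_0^\ast)\bigr),$$ where $N(0,0)$ denotes the point mass at $0$. -/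

import Mathlib

open MeasureTheory ProbabilityTheory Filter Topology Set

noncomputable section

namespace EstimatingEquation

variable {S Ω : Type*}

/-- `a` solves the population equation `Ψ(a) = E[ψ(Y; a)] = 0`, where `Y` has law `F`
(in particular the expectation exists). -/
def IsPopulationRoot [MeasurableSpace S] (ψ : S → ℝ → ℝ) (F : Measure S) (a : ℝ) : Prop :=
  Integrable (fun y => ψ y a) F ∧ ∫ y, ψ y a ∂F = 0

/-- The empirical score `Ψ_n(a) = n⁻¹ ∑ ψ(Y_i; a)`, the sum being over the first `n`
observations `Y 0, …, Y (n - 1)`. -/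
def empScore (ψ : S → ℝ → ℝ) (Y : ℕ → Ω → S) (n : ℕ) (a : ℝ) (ω : Ω) : ℝ :=
  (n : ℝ)⁻¹ * ∑ i ∈ Finset.range n, ψ (Y i ω) a

/-- The empirical mean of the derivatives, `Ψ_n'(u) = n⁻¹ ∑ ∂_a ψ(Y_i; a)|_{a = u}`. -/
def empScoreDeriv (ψ : S → ℝ → ℝ) (Y : ℕ → Ω → S) (n : ℕ) (u : ℝ) (ω : Ω) : ℝ :=
  (n : ℝ)⁻¹ * ∑ i ∈ Finset.range n, deriv (ψ (Y i ω)) u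

/-- The sensitivity `A = E[∂_a ψ(Y; a₀)]`. -/
def sensitivity [MeasurableSpace S] (ψ : S → ℝ → ℝ) (F : Measure S) (a₀ : ℝ) : ℝ :=
  ∫ y, deriv (ψ y) a₀ ∂F

/-- Local uniform control of the derivative at `a₀`: for every `ε > 0` there is `δ > 0` with
`P (sup_{|u - a₀| ≤ δ} |Ψ_n'(u) - Ψ_n'(a₀)| > ε) → 0` as `n → ∞`.
The supremum is taken in `[0, ∞]`, and `μ` of a set that is not measurable is its outer measure. -/
def LocallyUniformlyControlled [MeasurableSpace Ω] (ψ : S → ℝ → ℝ) (Y : ℕ → Ω → S)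
    (μ : Measure Ω) (a₀ : ℝ) : Prop :=
  ∀ ε : ℝ, 0 < ε → ∃ δ : ℝ, 0 < δ ∧
    Tendsto (fun n : ℕ => μ {ω | ENNReal.ofReal ε <
      ⨆ u ∈ Icc (a₀ - δ) (a₀ + δ), ‖empScoreDeriv ψ Y n u ω - empScoreDeriv ψ Y n a₀ ω‖ₑ})
      atTop (𝓝 0)

/-- The events `E n` occur with probability tending to one (stated as: the outer probability of
the complement tends to zero, so that no measurability of `E n` is presupposed). -/
def WithProbTendingToOne [MeasurableSpace Ω] (μ : Measure Ω) (E : ℕ → Set Ω) : Prop :=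
  Tendsto (fun n => μ (E n)ᶜ) atTop (𝓝 0)

/-- `a n` is a consistent sequence of roots: `Ψ_n(a n) = 0` with probability tending to one and
`a n → a₀` in probability. -/
def IsConsistentRoot [MeasurableSpace Ω] (ψ : S → ℝ → ℝ) (Y : ℕ → Ω → S)
    (μ : Measure Ω) (a₀ : ℝ) (a : ℕ → Ω → ℝ) : Prop :=
  WithProbTendingToOne μ (fun n => {ω | empScore ψ Y n (a n ω) ω = 0}) ∧
    TendstoInMeasure μ a atTop (fun _ => a₀)

end EstimatingEquation

end

/-! By the law of large numbers at `a₀` and the local control (A2), with probability tending to one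
`Ψ_n` has derivative within `ε` of `A` on a fixed interval around `a₀` (`exists_derivNear`). On
these events the rest is calculus. For `ε = |A| / 2`, the function `A * Ψ_n` increases with slope at
least `A ^ 2 / 2`. Since `Ψ_n(a₀) → 0` in probability, it crosses zero exactly once near `a₀`. A
supremum over rationals recovers this root measurably (`lastNegative`). For normality, the mean
value theorem between `a₀` and a consistent root gives `√n Ψ_n(a₀) = -d √n (a_n - a₀)` with `d`
close to `A` (`root_slope`). The central limit theorem on the left and Slutsky's theorem
(`tendstoInDistribution_of_slope`) yield the variance `B / A ^ 2`. -/

namespace EstimatingEquation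

/-- On `s`, the function `f` is differentiable with derivative within `ε` of `A`. -/
def DerivNear (f : ℝ → ℝ) (s : Set ℝ) (A ε : ℝ) : Prop :=
  ∀ u ∈ s, ∃ d, HasDerivAt f d u ∧ |d - A| ≤ ε

/-! ### Calculus of functions with derivative close to `A` -/

namespace DerivNear

variable {f : ℝ → ℝ} {s : Set ℝ} {A ε : ℝ}

lemma mono {t : Set ℝ} (h : DerivNear f s A ε) (hts : t ⊆ s) : DerivNear f t A ε :=
  fun u hu => h u (hts hu)

lemma continuousOn (h : DerivNear f s A ε) : ContinuousOn f s := fun u hu =>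
  let ⟨_, hd, _⟩ := h u hu
  hd.continuousAt.continuousWithinAt

lemma exists_slope_of_lt (h : DerivNear f s A ε) (hs : s.OrdConnected) {x y : ℝ}
    (hx : x ∈ s) (hy : y ∈ s) (hxy : x < y) :
    ∃ d, |d - A| ≤ ε ∧ f y - f x = d * (y - x) := by
  have hsub : Icc x y ⊆ s := hs.out hx hy
  have hder : ∀ u ∈ Icc x y, HasDerivAt f (deriv f u) u ∧ |deriv f u - A| ≤ ε := by
    intro u hu
    obtain ⟨d, hd, hdA⟩ := h u (hsub hu)
    rw [hd.deriv]
    exact ⟨hd, hdA⟩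
  obtain ⟨c, hc, hslope⟩ := exists_hasDerivAt_eq_slope f (deriv f) hxy
    (h.continuousOn.mono hsub) fun u hu => (hder u (Ioo_subset_Icc_self hu)).1
  refine ⟨deriv f c, (hder c (Ioo_subset_Icc_self hc)).2, ?_⟩
  rw [hslope, div_mul_cancel₀ _ (sub_pos.2 hxy).ne']

lemma exists_slope (h : DerivNear f s A ε) (hs : s.OrdConnected) (hε : 0 ≤ ε) {x y : ℝ}
    (hx : x ∈ s) (hy : y ∈ s) : ∃ d, |d - A| ≤ ε ∧ f y - f x = d * (y - x) := by
  rcases lt_trichotomy x y with hxy | rfl | hxy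
  · exact h.exists_slope_of_lt hs hx hy hxy
  · exact ⟨A, by simpa using hε, by simp⟩
  · obtain ⟨d, hd, hslope⟩ := h.exists_slope_of_lt hs hy hx hxy
    exact ⟨d, hd, by linarith⟩

/-- Multiplying by `A` treats both signs of `A` at once: a slope `d` within `|A| / 2` of `A`
satisfies `A * d ≥ A ^ 2 - A ^ 2 / 2`. -/
lemma half_sq_mul_le (h : DerivNear f s A (|A| / 2)) (hs : s.OrdConnected) {x y : ℝ}
    (hx : x ∈ s) (hy : y ∈ s) (hxy : x ≤ y) :
    A ^ 2 / 2 * (y - x) ≤ A * f y - A * f x := by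
  obtain ⟨d, hd, hslope⟩ := h.exists_slope hs (by positivity) hx hy
  have hAd : A ^ 2 / 2 ≤ A * d := by
    have h1 : |A * (d - A)| ≤ |A| * (|A| / 2) := by
      rw [abs_mul]
      gcongr
    have h2 := (abs_le.1 h1).1
    nlinarith [abs_mul_abs_self A]
  calc A ^ 2 / 2 * (y - x) ≤ A * d * (y - x) := by gcongr
    _ = A * f y - A * f x := by rw [mul_assoc, ← hslope]; ring

lemma strictMonoOn (h : DerivNear f s A (|A| / 2)) (hs : s.OrdConnected) (hA : A ≠ 0) :
    StrictMonoOn (fun a => A * f a) s := by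
  intro x hx y hy hxy
  have h1 := h.half_sq_mul_le hs hx hy hxy.le
  have h2 : 0 < A ^ 2 / 2 * (y - x) := mul_pos (by positivity) (sub_pos.2 hxy)
  simp only
  linarith

/-- On each side of `a₀` the function `A * f` changes by at least `A ^ 2 / 2 * δ`, which outweighs
`|A * f a₀|`, so the intermediate value theorem applies. -/
lemma exists_root {a₀ δ : ℝ} (h : DerivNear f (Icc (a₀ - δ) (a₀ + δ)) A (|A| / 2))
    (hA : A ≠ 0) (hδ : 0 ≤ δ) (h₀ : |f a₀| ≤ |A| / 2 * δ) :
    ∃ x ∈ Icc (a₀ - δ) (a₀ + δ), f x = 0 := by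
  have hl : a₀ - δ ∈ Icc (a₀ - δ) (a₀ + δ) := ⟨le_rfl, by linarith⟩
  have hm : a₀ ∈ Icc (a₀ - δ) (a₀ + δ) := ⟨by linarith, by linarith⟩
  have hr : a₀ + δ ∈ Icc (a₀ - δ) (a₀ + δ) := ⟨by linarith, le_rfl⟩
  have h1 := h.half_sq_mul_le ordConnected_Icc hl hm hm.1
  have h2 := h.half_sq_mul_le ordConnected_Icc hm hr hm.2
  have h3 : |A * f a₀| ≤ A ^ 2 / 2 * δ := by
    calc |A * f a₀| ≤ |A| * (|A| / 2 * δ) := by rw [abs_mul]; gcongr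
      _ = A ^ 2 / 2 * δ := by rw [← sq_abs A]; ring
  obtain ⟨h4, h5⟩ := abs_le.1 h3
  have hcont : ContinuousOn (fun a => A * f a) (Icc (a₀ - δ) (a₀ + δ)) :=
    continuousOn_const.mul h.continuousOn
  obtain ⟨x, hx, hfx⟩ := intermediate_value_Icc hl.2 hcont
    (show (0 : ℝ) ∈ Icc (A * f (a₀ - δ)) (A * f (a₀ + δ)) from
      ⟨by linarith, by linarith⟩)
  exact ⟨x, hx, (mul_eq_zero.1 hfx).resolve_left hA⟩

end DerivNear

/-! ### Measurable selection of the root -/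

/-- The supremum of the rational points of `[l, u]` at which `h` is negative (and of `l`). -/
noncomputable def lastNegative (l u : ℝ) (h : ℝ → ℝ) : ℝ :=
  ⨆ q : ℚ, if (q : ℝ) ∈ Icc l u ∧ h q < 0 then (q : ℝ) else l

lemma lastNegative_eq_root {l u x : ℝ} {h : ℝ → ℝ} (hmono : StrictMonoOn h (Icc l u))
    (hx : x ∈ Icc l u) (hroot : h x = 0) : lastNegative l u h = x := by
  have hle : ∀ q : ℚ, (if (q : ℝ) ∈ Icc l u ∧ h q < 0 then (q : ℝ) else l) ≤ x := by
    intro q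
    split_ifs with hq
    · exact ((hmono.lt_iff_lt hq.1 hx).1 (hq.2.trans_eq hroot.symm)).le
    · exact hx.1
  have hbdd : BddAbove (range fun q : ℚ =>
      if (q : ℝ) ∈ Icc l u ∧ h q < 0 then (q : ℝ) else l) := ⟨x, by rintro _ ⟨q, rfl⟩; exact hle q⟩
  refine le_antisymm (ciSup_le hle) (le_of_forall_lt fun c hc => ?_)
  rcases lt_or_ge c l with hcl | hlc
  -- Every term of the supremum is at least `l`; the index `0` is an arbitrary choice.
  · refine hcl.trans_le ((?_ : l ≤ _).trans (le_ciSup hbdd 0))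
    split_ifs with hq
    · exact hq.1.1
    · exact le_rfl
  · obtain ⟨q, hcq, hqx⟩ := exists_rat_btwn hc
    have hq : (q : ℝ) ∈ Icc l u := ⟨hlc.trans hcq.le, hqx.le.trans hx.2⟩
    have hneg : h q < 0 := hroot ▸ hmono hq hx hqx
    refine hcq.trans_le (le_of_eq_of_le ?_ (le_ciSup hbdd q))
    rw [if_pos ⟨hq, hneg⟩]

lemma aemeasurable_lastNegative {Ω : Type*} [MeasurableSpace Ω] {μ : Measure Ω}
    (l u : ℝ) {h : Ω → ℝ → ℝ} (hh : ∀ a, AEMeasurable (fun ω => h ω a) μ) :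
    AEMeasurable (fun ω => lastNegative l u (h ω)) μ := by
  refine AEMeasurable.iSup fun q => ?_
  by_cases hq : (q : ℝ) ∈ Icc l u
  · simp only [hq, true_and]
    have hstep : Measurable fun t : ℝ => if t < 0 then (q : ℝ) else l :=
      Measurable.ite measurableSet_Iio measurable_const measurable_const
    exact hstep.comp_aemeasurable (hh q)
  · simp [hq]

/-! ### Events of probability tending to one, limit theorems, existence of roots -/

section Probability

variable {S Ω : Type*} [MeasurableSpace S] [MeasurableSpace Ω] {μ : Measure Ω}

lemma WithProbTendingToOne.mono {E E' : ℕ → Set Ω} (h : WithProbTendingToOne μ E)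
    (hE : ∀ n, ∀ᵐ ω ∂μ, ω ∈ E n → ω ∈ E' n) : WithProbTendingToOne μ E' :=
  tendsto_of_tendsto_of_tendsto_of_le_of_le tendsto_const_nhds h (fun _ => zero_le)
    fun n => measure_mono_ae ((hE n).mono fun _ hω hn hmem => hn (hω hmem))

lemma WithProbTendingToOne.inter {E E' : ℕ → Set Ω} (h : WithProbTendingToOne μ E)
    (h' : WithProbTendingToOne μ E') : WithProbTendingToOne μ (fun n => E n ∩ E' n) := by
  have hsum : Tendsto (fun n => μ (E n)ᶜ + μ (E' n)ᶜ) atTop (𝓝 0) := by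
    simpa using Tendsto.add h h'
  refine tendsto_of_tendsto_of_tendsto_of_le_of_le tendsto_const_nhds hsum
    (fun _ => zero_le) fun n => ?_
  simp only [compl_inter]
  exact measure_union_le _ _

lemma tendstoInMeasure_of_withProbTendingToOne {X : ℕ → Ω → ℝ} {Z : Ω → ℝ}
    (h : ∀ ε : ℝ, 0 < ε → WithProbTendingToOne μ (fun n => {ω | |X n ω - Z ω| < ε})) :
    TendstoInMeasure μ X atTop Z := by
  rw [tendstoInMeasure_iff_norm]
  intro ε hε
  simpa [WithProbTendingToOne, compl_ofPred] using h ε hε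

lemma withProbTendingToOne_of_tendstoInMeasure {X : ℕ → Ω → ℝ} {Z : Ω → ℝ}
    (h : TendstoInMeasure μ X atTop Z) {ε : ℝ} (hε : 0 < ε) :
    WithProbTendingToOne μ (fun n => {ω | |X n ω - Z ω| < ε}) := by
  rw [tendstoInMeasure_iff_norm] at h
  simpa [WithProbTendingToOne, compl_ofPred] using h ε hε

variable {F : Measure S} {Y : ℕ → Ω → S}

lemma identDistrib_comp (hLaw : ∀ i, HasLaw (Y i) F μ) {g : S → ℝ} (hg : AEMeasurable g F)
    (i : ℕ) : IdentDistrib (fun ω => g (Y i ω)) (fun ω => g (Y 0 ω)) μ μ := by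
  have hid : IdentDistrib (Y i) (Y 0) μ μ :=
    ⟨(hLaw i).aemeasurable, (hLaw 0).aemeasurable, (hLaw i).map_eq.trans (hLaw 0).map_eq.symm⟩
  exact hid.comp_of_aemeasurable ((hLaw i).map_eq.symm ▸ hg)

lemma iIndepFun_comp (hLaw : ∀ i, HasLaw (Y i) F μ) (hIndep : iIndepFun Y μ) {g : S → ℝ}
    (hg : AEMeasurable g F) : iIndepFun (fun i ω => g (Y i ω)) μ :=
  hIndep.comp₀ (fun _ => g) (fun i => (hLaw i).aemeasurable) fun i => (hLaw i).map_eq.symm ▸ hg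

lemma aemeasurable_mean (hLaw : ∀ i, HasLaw (Y i) F μ) {g : S → ℝ} (hg : AEMeasurable g F)
    (n : ℕ) : AEMeasurable (fun ω => (n : ℝ)⁻¹ * ∑ i ∈ Finset.range n, g (Y i ω)) μ :=
  (Finset.aemeasurable_fun_sum _ fun i _ => (identDistrib_comp hLaw hg i).aemeasurable_fst).const_mul
    _

/-- Weak law of large numbers for the empirical mean of an integrable function. -/
lemma tendstoInMeasure_mean [IsProbabilityMeasure μ] (hLaw : ∀ i, HasLaw (Y i) F μ)
    (hIndep : iIndepFun Y μ) {g : S → ℝ} (hg : Integrable g F) :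
    TendstoInMeasure μ (fun (n : ℕ) ω => (n : ℝ)⁻¹ * ∑ i ∈ Finset.range n, g (Y i ω)) atTop
      (fun _ => ∫ y, g y ∂F) := by
  have hgm : AEMeasurable g F := hg.aestronglyMeasurable.aemeasurable
  refine tendstoInMeasure_of_tendsto_ae
    (fun n => (aemeasurable_mean hLaw hgm n).aestronglyMeasurable) ?_
  have hint : Integrable (fun ω => g (Y 0 ω)) μ := by
    have hg' : Integrable g (μ.map (Y 0)) := (hLaw 0).map_eq.symm ▸ hg
    exact hg'.comp_aemeasurable (hLaw 0).aemeasurable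
  have hmean : ∫ ω, g (Y 0 ω) ∂μ = ∫ y, g y ∂F :=
    (hLaw 0).integral_comp hg.aestronglyMeasurable
  have hslln := strong_law_ae_real (fun i ω => g (Y i ω)) hint
    (fun i j hij => (iIndepFun_comp hLaw hIndep hgm).indepFun hij) (identDistrib_comp hLaw hgm)
  filter_upwards [hslln] with ω hω
  rw [← hmean]
  exact hω.congr fun n => by rw [div_eq_inv_mul]

/-- Central limit theorem for the empirical mean of a centred square integrable function. -/
lemma tendstoInDistribution_sqrt_mul_mean [IsProbabilityMeasure μ]
    (hLaw : ∀ i, HasLaw (Y i) F μ) (hIndep : iIndepFun Y μ) {g : S → ℝ} (hg : MemLp g 2 F)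
    (hg₀ : ∫ y, g y ∂F = 0) {Ω' : Type*} [MeasurableSpace Ω'] {P' : Measure Ω'}
    [IsProbabilityMeasure P'] {Z : Ω' → ℝ} (hZ : HasLaw Z (gaussianReal 0 Var[g; F].toNNReal) P') :
    TendstoInDistribution
      (fun (n : ℕ) ω => √(n : ℝ) * ((n : ℝ)⁻¹ * ∑ i ∈ Finset.range n, g (Y i ω))) atTop Z
      (fun _ => μ) P' := by
  have hgm : AEMeasurable g F := hg.aestronglyMeasurable.aemeasurable
  have hL2 : MemLp (fun ω => g (Y 0 ω)) 2 μ := by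
    have hg' : MemLp g 2 (μ.map (Y 0)) := (hLaw 0).map_eq.symm ▸ hg
    exact hg'.comp_of_map (hLaw 0).aemeasurable
  have hmean : ∫ ω, g (Y 0 ω) ∂μ = 0 :=
    ((hLaw 0).integral_comp hg.aestronglyMeasurable).trans hg₀
  have hvar : Var[fun ω => g (Y 0 ω); μ] = Var[g; F] := by
    have hg' : AEMeasurable g (μ.map (Y 0)) := (hLaw 0).map_eq.symm ▸ hgm
    have := variance_map hg' (hLaw 0).aemeasurable
    rw [(hLaw 0).map_eq] at this
    exact this.symm
  have hclt := tendstoInDistribution_inv_sqrt_mul_sum_sub (X := fun i ω => g (Y i ω))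
    (by rw [hvar]; exact hZ) hL2 (iIndepFun_comp hLaw hIndep hgm) (identDistrib_comp hLaw hgm)
  refine hclt.congr (fun n => .of_forall fun ω => ?_) (.refl _ _)
  simp only [hmean, mul_zero, sub_zero, ← mul_assoc]
  congr 1
  rw [← div_eq_mul_inv, Real.sqrt_div_self]

variable {ψ : S → ℝ → ℝ} {a₀ : ℝ}

/-- With probability tending to one, the empirical score has a derivative close to the
sensitivity throughout a neighbourhood of `a₀`. -/
lemma exists_derivNear [IsProbabilityMeasure μ] (hLaw : ∀ i, HasLaw (Y i) F μ)
    (hIndep : iIndepFun Y μ)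
    (hDiff : ∃ r : ℝ, 0 < r ∧
      ∀ᵐ y ∂F, ∀ a ∈ Ioo (a₀ - r) (a₀ + r), DifferentiableAt ℝ (ψ y) a)
    (hA1 : Integrable (fun y => deriv (ψ y) a₀) F)
    (hA2 : LocallyUniformlyControlled ψ Y μ a₀) {ε : ℝ} (hε : 0 < ε) :
    ∃ δ : ℝ, 0 < δ ∧ WithProbTendingToOne μ (fun n =>
      {ω | DerivNear (fun a => empScore ψ Y n a ω) (Icc (a₀ - δ) (a₀ + δ))
        (sensitivity ψ F a₀) ε}) := by
  obtain ⟨r, hr, hdiff⟩ := hDiff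
  obtain ⟨δ₁, hδ₁, hctrl⟩ := hA2 (ε / 2) (half_pos hε)
  have hctrl' : WithProbTendingToOne μ (fun n => {ω | ¬ ENNReal.ofReal (ε / 2) <
      ⨆ u ∈ Icc (a₀ - δ₁) (a₀ + δ₁),
        ‖empScoreDeriv ψ Y n u ω - empScoreDeriv ψ Y n a₀ ω‖ₑ}) := by
    simpa only [WithProbTendingToOne, compl_ofPred, not_not] using hctrl
  have hlln := withProbTendingToOne_of_tendstoInMeasure
    (tendstoInMeasure_mean hLaw hIndep hA1) (half_pos hε)
  have hdiff' : ∀ᵐ ω ∂μ, ∀ i, ∀ a ∈ Ioo (a₀ - r) (a₀ + r), DifferentiableAt ℝ (ψ (Y i ω)) a :=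
    ae_all_iff.2 fun i => ae_of_ae_map (hLaw i).aemeasurable ((hLaw i).map_eq.symm ▸ hdiff)
  -- Halving `r` puts the closed interval inside the open interval of differentiability.
  refine ⟨min δ₁ (r / 2), by positivity, (hctrl'.inter hlln).mono fun n => ?_⟩
  filter_upwards [hdiff'] with ω hω hmem u hu
  obtain ⟨hsup, hmean⟩ := hmem
  have hu₁ : u ∈ Icc (a₀ - δ₁) (a₀ + δ₁) :=
    ⟨by linarith [hu.1, min_le_left δ₁ (r / 2)], by linarith [hu.2, min_le_left δ₁ (r / 2)]⟩
  have hu₂ : u ∈ Ioo (a₀ - r) (a₀ + r) :=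
    ⟨by linarith [hu.1, min_le_right δ₁ (r / 2)], by linarith [hu.2, min_le_right δ₁ (r / 2)]⟩
  refine ⟨empScoreDeriv ψ Y n u ω, ?_, ?_⟩
  · exact (HasDerivAt.fun_sum fun i _ => (hω i u hu₂).hasDerivAt).const_mul _
  · have h1 : ‖empScoreDeriv ψ Y n u ω - empScoreDeriv ψ Y n a₀ ω‖ₑ ≤ ENNReal.ofReal (ε / 2) :=
      (le_iSup₂ (f := fun u (_ : u ∈ Icc (a₀ - δ₁) (a₀ + δ₁)) =>
        ‖empScoreDeriv ψ Y n u ω - empScoreDeriv ψ Y n a₀ ω‖ₑ) u hu₁).trans (not_lt.1 hsup)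
    rw [← ofReal_norm, ENNReal.ofReal_le_ofReal_iff (half_pos hε).le, Real.norm_eq_abs] at h1
    have h2 : |empScoreDeriv ψ Y n a₀ ω - sensitivity ψ F a₀| < ε / 2 := hmean
    linarith [abs_sub_le (empScoreDeriv ψ Y n u ω) (empScoreDeriv ψ Y n a₀ ω)
      (sensitivity ψ F a₀)]

/-- The empirical score at the population root is small with probability tending to one. -/
lemma empScore_small [IsProbabilityMeasure μ] (hLaw : ∀ i, HasLaw (Y i) F μ)
    (hIndep : iIndepFun Y μ) (hRoot : IsPopulationRoot ψ F a₀) {ε : ℝ} (hε : 0 < ε) :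
    WithProbTendingToOne μ (fun n => {ω | |empScore ψ Y n a₀ ω| < ε}) := by
  have h := withProbTendingToOne_of_tendstoInMeasure
    (tendstoInMeasure_mean hLaw hIndep hRoot.1) hε
  simpa only [hRoot.2, sub_zero, empScore] using h

/-- If the derivative of the empirical score is controlled near `a₀`, the empirical score has a
root in every small neighbourhood of `a₀` with probability tending to one. -/
lemma exists_root_of_derivNear [IsProbabilityMeasure μ] (hLaw : ∀ i, HasLaw (Y i) F μ)
    (hIndep : iIndepFun Y μ) (hRoot : IsPopulationRoot ψ F a₀) {A δ₀ : ℝ} (hA : A ≠ 0)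
    (hD : WithProbTendingToOne μ (fun n =>
      {ω | DerivNear (fun a => empScore ψ Y n a ω) (Icc (a₀ - δ₀) (a₀ + δ₀)) A (|A| / 2)}))
    {δ : ℝ} (hδ : δ ∈ Ioc 0 δ₀) :
    WithProbTendingToOne μ (fun n =>
      {ω | DerivNear (fun a => empScore ψ Y n a ω) (Icc (a₀ - δ₀) (a₀ + δ₀)) A (|A| / 2) ∧
        ∃ x ∈ Icc (a₀ - δ) (a₀ + δ), empScore ψ Y n x ω = 0}) := by
  have hpos : 0 < |A| / 2 * δ := mul_pos (by positivity) hδ.1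
  refine (hD.inter (empScore_small hLaw hIndep hRoot hpos)).mono
    fun n => .of_forall fun ω hω => ⟨hω.1, ?_⟩
  exact (hω.1.mono (Icc_subset_Icc (by linarith [hδ.2]) (by linarith [hδ.2]))).exists_root hA
    hδ.1.le (le_of_lt hω.2)

lemma existsUnique_root [IsProbabilityMeasure μ] (hLaw : ∀ i, HasLaw (Y i) F μ)
    (hIndep : iIndepFun Y μ) (hRoot : IsPopulationRoot ψ F a₀) {A δ₀ : ℝ} (hA : A ≠ 0)
    (hD : WithProbTendingToOne μ (fun n =>
      {ω | DerivNear (fun a => empScore ψ Y n a ω) (Icc (a₀ - δ₀) (a₀ + δ₀)) A (|A| / 2)}))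
    {δ : ℝ} (hδ : δ ∈ Ioc 0 δ₀) :
    WithProbTendingToOne μ (fun n =>
      {ω | ∃! a : ℝ, a ∈ Icc (a₀ - δ) (a₀ + δ) ∧ empScore ψ Y n a ω = 0}) := by
  refine (exists_root_of_derivNear hLaw hIndep hRoot hA hD hδ).mono
    fun n => .of_forall fun ω hω => ?_
  obtain ⟨hder, x, hx, hroot⟩ := hω
  have hsub : Icc (a₀ - δ) (a₀ + δ) ⊆ Icc (a₀ - δ₀) (a₀ + δ₀) :=
    Icc_subset_Icc (by linarith [hδ.2]) (by linarith [hδ.2])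
  have hinj := ((hder.mono hsub).strictMonoOn ordConnected_Icc hA).injOn
  exact ⟨x, ⟨hx, hroot⟩, fun y hy => hinj hy.1 hx (by simp [hy.2, hroot])⟩

/-- One sequence serves every `δ ≤ δ₀`: a root in the `δ`-interval is the unique root in the
`δ₀`-interval, hence the selected one. As the `Y i` are only a.e. measurable, a measurable
modification is taken. -/
lemma exists_consistentRoot [IsProbabilityMeasure μ] (hLaw : ∀ i, HasLaw (Y i) F μ)
    (hIndep : iIndepFun Y μ) (hMeas : ∀ a, Measurable (fun y => ψ y a))
    (hRoot : IsPopulationRoot ψ F a₀) {A δ₀ : ℝ} (hA : A ≠ 0) (hδ₀ : 0 < δ₀)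
    (hD : WithProbTendingToOne μ (fun n =>
      {ω | DerivNear (fun a => empScore ψ Y n a ω) (Icc (a₀ - δ₀) (a₀ + δ₀)) A (|A| / 2)})) :
    ∃ a : ℕ → Ω → ℝ, (∀ n, Measurable (a n)) ∧ IsConsistentRoot ψ Y μ a₀ a := by
  have hb (n : ℕ) : AEMeasurable (fun ω =>
      lastNegative (a₀ - δ₀) (a₀ + δ₀) fun a => A * empScore ψ Y n a ω) μ :=
    aemeasurable_lastNegative _ _ fun a =>
      (aemeasurable_mean hLaw (hMeas a).aemeasurable n).const_mul A
  have key : ∀ δ ∈ Ioc 0 δ₀, WithProbTendingToOne μ (fun n => {ω |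
      (hb n).mk _ ω ∈ Icc (a₀ - δ) (a₀ + δ) ∧ empScore ψ Y n ((hb n).mk _ ω) ω = 0}) := by
    intro δ hδ
    refine (exists_root_of_derivNear hLaw hIndep hRoot hA hD hδ).mono fun n => ?_
    filter_upwards [(hb n).ae_eq_mk] with ω hω hmem
    obtain ⟨hder, x, hx, hroot⟩ := hmem
    have hlast := lastNegative_eq_root (hder.strictMonoOn ordConnected_Icc hA)
      (Icc_subset_Icc (by linarith [hδ.2]) (by linarith [hδ.2]) hx) (by simp [hroot])
    have hmk : (hb n).mk _ ω = x := hω.symm.trans hlast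
    simpa only [mem_ofPred_eq, hmk] using And.intro hx hroot
  refine ⟨fun n => (hb n).mk _, fun n => (hb n).measurable_mk, ?_, ?_⟩
  · exact (key δ₀ ⟨hδ₀, le_rfl⟩).mono fun n => .of_forall fun ω hω => hω.2
  · refine tendstoInMeasure_of_withProbTendingToOne fun ε hε => ?_
    refine (key (min δ₀ (ε / 2)) ⟨by positivity, min_le_left _ _⟩).mono
      fun n => .of_forall fun ω hω => ?_
    have h1 := min_le_right δ₀ (ε / 2)
    obtain ⟨⟨h2, h3⟩, -⟩ := hω
    rw [mem_ofPred_eq, abs_lt]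
    exact ⟨by linarith, by linarith⟩

end Probability

/-! ### Linearization at the root and Slutsky's theorem -/

section Slope

variable {S Ω : Type*} [MeasurableSpace Ω] {μ : Measure Ω} {Y : ℕ → Ω → S} {ψ : S → ℝ → ℝ} {a₀ : ℝ}

/-- With probability tending to one, the scaled empirical score at `a₀` is minus the scaled error
of the root times a slope close to `A`. -/
lemma root_slope {A ε δ : ℝ} (hε : 0 < ε) (hδ : 0 < δ)
    (hD : WithProbTendingToOne μ (fun n =>
      {ω | DerivNear (fun a => empScore ψ Y n a ω) (Icc (a₀ - δ) (a₀ + δ)) A ε}))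
    {a : ℕ → Ω → ℝ} (ha : IsConsistentRoot ψ Y μ a₀ a) :
    WithProbTendingToOne μ (fun n =>
      {ω | ∃ d, |d - A| ≤ ε ∧ √(n : ℝ) * empScore ψ Y n a₀ ω
        = -d * (√(n : ℝ) * (a n ω - a₀))}) := by
  refine ((hD.inter ha.1).inter (withProbTendingToOne_of_tendstoInMeasure ha.2 hδ)).mono
    fun n => .of_forall fun ω hω => ?_
  obtain ⟨⟨hder, hroot⟩, hclose⟩ := hω
  rw [mem_ofPred_eq, abs_lt] at hclose
  obtain ⟨h1, h2⟩ := hclose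
  obtain ⟨d, hd, hslope⟩ := hder.exists_slope ordConnected_Icc hε.le
    (show a₀ ∈ _ from ⟨by linarith, by linarith⟩)
    (show a n ω ∈ _ from ⟨by linarith, by linarith⟩)
  refine ⟨d, hd, ?_⟩
  have hroot' : empScore ψ Y n (a n ω) ω = 0 := hroot
  simp only [hroot'] at hslope
  linear_combination -√(n : ℝ) * hslope

/-- If `W n = -d n * V n` with `d n` close to `A ≠ 0` with probability tending to one, and `W n`
converges in distribution to `Z`, then `V n` converges in distribution to `-A⁻¹ * Z`. -/
lemma tendstoInDistribution_of_slope [IsProbabilityMeasure μ] {W V : ℕ → Ω → ℝ} {A : ℝ}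
    (hA : A ≠ 0) (hV : ∀ n, AEMeasurable (V n) μ)
    {Ω' : Type*} [MeasurableSpace Ω'] {P' : Measure Ω'} [IsProbabilityMeasure P'] {Z : Ω' → ℝ}
    (hW : TendstoInDistribution W atTop Z (fun _ => μ) P')
    (h : ∀ ε : ℝ, 0 < ε → WithProbTendingToOne μ (fun n =>
      {ω | ∃ d, |d - A| ≤ ε ∧ W n ω = -d * V n ω})) :
    TendstoInDistribution V atTop (fun ω => Z ω * (-A⁻¹)) (fun _ => μ) P' := by
  classical
  -- The slope `d` need not be measurable in `ω`, so `-d⁻¹` is replaced by the quotient `V n / W n`.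
  -- Where `W n = 0` the default is the limit `-A⁻¹` itself, so that convergence in probability is
  -- unaffected.
  let R : ℕ → Ω → ℝ := fun n ω => if W n ω = 0 then -A⁻¹ else V n ω / W n ω
  have hWm := hW.forall_aemeasurable
  have hR (n : ℕ) : AEMeasurable (R n) μ := by
    have hstep : Measurable fun p : ℝ × ℝ => if p.1 = 0 then -A⁻¹ else p.2 / p.1 :=
      Measurable.ite (measurable_fst (measurableSet_singleton 0)) measurable_const
        (measurable_snd.div measurable_fst)
    exact hstep.comp_aemeasurable ((hWm n).prodMk (hV n))
  have hRlim : TendstoInMeasure μ R atTop (fun _ => -A⁻¹) := by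
    refine tendstoInMeasure_of_withProbTendingToOne fun ε hε => ?_
    obtain ⟨η, hη, hinv⟩ := Metric.continuousAt_iff.1 (continuousAt_inv₀ hA) ε hε
    refine (h (η / 2) (half_pos hη)).mono fun n => .of_forall fun ω hω => ?_
    obtain ⟨d, hd, hWV⟩ := hω
    change |R n ω - -A⁻¹| < ε
    by_cases hW₀ : W n ω = 0
    · simpa [R, hW₀] using hε
    · have hd₀ : d ≠ 0 := by rintro rfl; simp [hWV] at hW₀
      have hV₀ : V n ω ≠ 0 := by rintro hV₀; simp [hWV, hV₀] at hW₀
      have hdist : dist d⁻¹ A⁻¹ < ε := hinv (by rw [Real.dist_eq]; linarith)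
      have hRd : R n ω = -d⁻¹ := by
        simp only [R, if_neg hW₀]
        rw [hWV]
        field_simp
      rwa [hRd, neg_sub_neg, abs_sub_comm, ← Real.dist_eq]
  have hprod : TendstoInDistribution (fun n ω => W n ω * R n ω) atTop
      (fun ω => Z ω * (-A⁻¹)) (fun _ => μ) P' :=
    hW.continuous_comp_prodMk_of_tendstoInMeasure_const (g := fun p : ℝ × ℝ => p.1 * p.2)
      (by fun_prop) hRlim hR
  refine tendstoInDistribution_of_tendstoInMeasure_sub V _ hprod ?_ hV
  refine tendstoInMeasure_of_withProbTendingToOne fun ε hε => ?_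
  -- This tolerance keeps `d ≠ 0`, so `W n = 0` forces `V n = 0` and `V n = W n * R n` holds
  -- exactly.
  refine (h (|A| / 2) (by positivity)).mono fun n => .of_forall fun ω hω => ?_
  obtain ⟨d, hd, hWV⟩ := hω
  have hVR : V n ω = W n ω * R n ω := by
    by_cases hW₀ : W n ω = 0
    · have hd₀ : d ≠ 0 := by
        rintro rfl
        rw [zero_sub, abs_neg] at hd
        linarith [abs_pos.2 hA]
      have hV₀ : V n ω = 0 := by simpa [hW₀, hd₀] using hWV.symm
      rw [hW₀, hV₀, zero_mul]
    · simp only [R, if_neg hW₀]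
      rw [mul_div_cancel₀ _ hW₀]
  simpa [← hVR] using hε

end Slope

end EstimatingEquation

open EstimatingEquation in
theorem mainTheorem4 {S Ω : Type*} [MeasurableSpace S] [MeasurableSpace Ω]
    (μ : Measure Ω) [IsProbabilityMeasure μ] (F : Measure S)
    (Y : ℕ → Ω → S) (hLaw : ∀ i, HasLaw (Y i) F μ) (hIndep : iIndepFun Y μ)
    (ψ : S → ℝ → ℝ) (hMeas : ∀ a, Measurable (fun y => ψ y a))
    (a₀ : ℝ) (hRoot : EstimatingEquation.IsPopulationRoot ψ F a₀)
    (hUnique : ∀ a, EstimatingEquation.IsPopulationRoot ψ F a → a = a₀)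
    (hDiff : ∃ r : ℝ, 0 < r ∧
      ∀ᵐ y ∂F, ∀ a ∈ Ioo (a₀ - r) (a₀ + r), DifferentiableAt ℝ (ψ y) a)
    (hA1_int : Integrable (fun y => deriv (ψ y) a₀) F)
    (hA1 : EstimatingEquation.sensitivity ψ F a₀ ≠ 0)
    (hA2 : EstimatingEquation.LocallyUniformlyControlled ψ Y μ a₀)
    (hA3 : Integrable (fun y => ψ y a₀ ^ 2) F) :
    (∃ δ₀ : ℝ, 0 < δ₀ ∧ ∀ δ ∈ Ioc 0 δ₀,
      EstimatingEquation.WithProbTendingToOne μ (fun n =>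
        {ω | ∃! a : ℝ, a ∈ Icc (a₀ - δ) (a₀ + δ) ∧
          EstimatingEquation.empScore ψ Y n a ω = 0})) ∧
    (∃ a : ℕ → Ω → ℝ, (∀ n, Measurable (a n)) ∧
      EstimatingEquation.IsConsistentRoot ψ Y μ a₀ a) ∧
    (∀ a : ℕ → Ω → ℝ, (∀ n, AEMeasurable (a n) μ) →
      EstimatingEquation.IsConsistentRoot ψ Y μ a₀ a →
      TendstoInDistribution (fun (n : ℕ) ω => √(n : ℝ) * (a n ω - a₀)) atTop (id : ℝ → ℝ)
        (fun _ => μ)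
        (gaussianReal 0 (Real.toNNReal
          (Var[fun y => ψ y a₀; F] / EstimatingEquation.sensitivity ψ F a₀ ^ 2)))) := by
  have hD : ∀ ε : ℝ, 0 < ε → _ := fun ε hε => exists_derivNear hLaw hIndep hDiff hA1_int hA2 hε
  obtain ⟨δ₀, hδ₀, hD₀⟩ := hD (|EstimatingEquation.sensitivity ψ F a₀| / 2)
    (half_pos (abs_pos.2 hA1))
  refine ⟨⟨δ₀, hδ₀, fun δ hδ => existsUnique_root hLaw hIndep hRoot hA1 hD₀ hδ⟩,
    exists_consistentRoot hLaw hIndep hMeas hRoot hA1 hδ₀ hD₀, fun a ha haroot => ?_⟩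
  set A := EstimatingEquation.sensitivity ψ F a₀
  set B := Var[fun y => ψ y a₀; F]
  -- The limit of the central limit theorem is realized as `-A * x` on the target Gaussian space, so
  -- that Slutsky's factor `-A⁻¹` turns it into `id`.
  have hZ : HasLaw (fun x : ℝ => -A * x) (gaussianReal 0 B.toNNReal)
      (gaussianReal 0 (B / A ^ 2).toNNReal) := by
    have hlaw := gaussianReal_const_mul
      (HasLaw.id (μ := gaussianReal 0 (B / A ^ 2).toNNReal)) (-A)
    have hB : 0 ≤ B := variance_nonneg _ _
    have hv : NNReal.mk ((-A) ^ 2) (sq_nonneg _) * (B / A ^ 2).toNNReal = B.toNNReal := by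
      ext
      rw [NNReal.coe_mul, NNReal.coe_mk, Real.coe_toNNReal _ (by positivity),
        Real.coe_toNNReal _ hB]
      field_simp
    rw [mul_zero, hv] at hlaw
    exact hlaw
  have hL2 : MemLp (fun y => ψ y a₀) 2 F :=
    (memLp_two_iff_integrable_sq (hMeas a₀).aestronglyMeasurable).2 hA3
  have hclt := tendstoInDistribution_sqrt_mul_mean hLaw hIndep hL2 hRoot.2 hZ
  have hV (n : ℕ) : AEMeasurable (fun ω => √(n : ℝ) * (a n ω - a₀)) μ :=
    ((ha n).sub_const a₀).const_mul _
  refine (tendstoInDistribution_of_slope hA1 hV hclt fun ε hε => ?_).congr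
    (fun n => .refl _ _) (.of_forall fun x => ?_)
  · obtain ⟨δ, hδ, hDε⟩ := hD ε hε
    exact root_slope hε hδ hDε haroot
  · simp only [id]
    field_simp
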